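/- Let $\mathcal X$ be a finite-dimensional complex Hilbert space and let $A$ be a linear operator on $\mathcal X$ that is stable (every eigenvalue of $A$ has negative real part) and dissipative ($A^*+A\le 0$), and such that $\operatorname{rank}(A^*+A)=1$. Let $\varphi$ be a rational Blaschke product of degree $n=\deg\varphi\ge 0$ for the right half plane, that is, $$\varphi(s)=\rho\prod_{k=1}^{n}\frac{s+\overline{\alpha}_k}{s-\alpha_k},\qquad |\rho|=1,\quad \operatorname{Re}\alpha_k<0\ \ (k=1,\dots,n).$$ For an operator $T$ on $\mathcal X$ having no pole of $\varphi$ as an eigenvalue, let $\varphi(T)=p(T)\,q(T)^{-1}$, where $\varphi=p/q$ in lowest terms. For a contraction $T$ on $\mathcal X$, let the defect index $\mathfrak d_T$ be the dimension of the range of the positive square root $(I-T^*T)^{1/2}$. Then $\varphi(-A)$ and $\varphi(-A^*)$ are well defined, they are contractions, and $$\mathfrak d_{\varphi(-A)}=\mathfrak d_{\varphi(-A^*)}=\min\{\deg\varphi,\ \dim\mathcal X\}.$$ -/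

import Mathlib

open scoped InnerProductSpace

noncomputable section

namespace BlaschkeDefect

section Operators

variable {X : Type*} [NormedAddCommGroup X] [InnerProductSpace ℂ X]

/-- An operator is stable if all its eigenvalues lie in the open left half plane. -/
def IsStable (A : X →L[ℂ] X) : Prop :=
  ∀ z : ℂ, Module.End.HasEigenvalue (A : X →ₗ[ℂ] X) z → z.re < 0

/-- An operator is dissipative if `A* + A ≤ 0` (in the Loewner order). -/
def IsDissipative [CompleteSpace X] (A : X →L[ℂ] X) : Prop :=
  ContinuousLinearMap.adjoint A + A ≤ 0

/-- The rank of an operator on a finite-dimensional space: the dimension of its range. -/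
def opRank [FiniteDimensional ℂ X] (T : X →L[ℂ] X) : ℕ :=
  Module.finrank ℂ (LinearMap.range (T : X →ₗ[ℂ] X))

/-- The defect operator `D_T`, i.e. the positive square root of `I - T* T`, of a contraction `T`. -/
def defectOperator [CompleteSpace X] (T : X →L[ℂ] X) : X →L[ℂ] X :=
  CFC.sqrt (1 - ContinuousLinearMap.adjoint T * T)

/-- The defect index of a contraction `T` on a finite-dimensional Hilbert space: the dimension
of the range of `D_T` (which is closed, the space being finite-dimensional). -/
def defectIndex [CompleteSpace X] [FiniteDimensional ℂ X] (T : X →L[ℂ] X) : ℕ :=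
  opRank (defectOperator T)

/-- The denominator of `f`, in lowest terms, is invertible at `T`; equivalently (in finite
dimension) no pole of `f` is an eigenvalue of `T`. -/
def RatDefinedAt (f : RatFunc ℂ) (T : X →L[ℂ] X) : Prop :=
  IsUnit (Polynomial.aeval T f.denom)

/-- The value `f(T) = p(T) q(T)⁻¹` of the rational function `f = p / q` (in lowest terms) at the
operator `T`; meaningful when `RatDefinedAt f T` holds. -/
def ratEval (f : RatFunc ℂ) (T : X →L[ℂ] X) : X →L[ℂ] X :=
  Polynomial.aeval T f.num * Ring.inverse (Polynomial.aeval T f.denom)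

end Operators

/-- `φ` is a (rational) Blaschke product of degree `n` for the right half plane:
`φ(s) = ρ ∏_{k=1}^n (s + conj α_k) / (s - α_k)` with `|ρ| = 1` and `Re α_k < 0` for all `k`.
No cancellation can occur between the factors, so `φ` determines `n`. -/
def IsBlaschkeProduct (φ : RatFunc ℂ) (n : ℕ) : Prop :=
  ∃ (ρ : ℂ) (α : Fin n → ℂ), ‖ρ‖ = 1 ∧ (∀ k, (α k).re < 0) ∧
    φ = RatFunc.C ρ *
      ∏ k, (RatFunc.X + RatFunc.C ((starRingEnd ℂ) (α k))) / (RatFunc.X - RatFunc.C (α k))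

end BlaschkeDefect

end

open Polynomial ContinuousLinearMap
open scoped InnerProductSpace

namespace BlaschkeDefect

variable {X : Type*} [NormedAddCommGroup X] [InnerProductSpace ℂ X]

/-! Put `B = -A` and `D = B* + B ≥ 0`, and write `φ = ρ Z / Q`. For each pole `a`, the gap `‖(B -
a)z‖² - ‖(B + ā)z‖²` equals `-2 Re a ⟪Dz, z⟫ ≥ 0`. Replacing factors of `Q` by factors of `Z` one at
a time gives `‖Z(B)y‖ ≤ ‖Q(B)y‖`, so `φ(B)` is a contraction; equality holds exactly when `D B^j y =
0` for all `j < n` (`norm_aeval_zeroProd`). Hence `Q(B)` carries this unobservable space onto the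
kernel of the defect operator. As `D` has rank one and `B` has no imaginary eigenvalue, the space
loses one dimension per step until it vanishes (`finrank_unobservable`). The adjoint satisfies the
same hypotheses. -/

theorem mul_apply_eq (S T : X →L[ℂ] X) (x : X) : (S * T) x = S (T x) := rfl

/-- The vectors annihilated by `D`, `D B`, …, `D B ^ (n - 1)`. -/
def unobservable (D B : X →L[ℂ] X) (n : ℕ) : Submodule ℂ X where
  carrier := {y | ∀ j < n, D ((B ^ j) y) = 0}
  zero_mem' := by simp
  add_mem' := by
    intro a b ha hb j hj
    rw [map_add, map_add, ha j hj, hb j hj, add_zero]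
  smul_mem' := by
    intro c a ha j hj
    rw [map_smul, map_smul, ha j hj, smul_zero]

theorem mem_unobservable {D B : X →L[ℂ] X} {n : ℕ} {y : X} :
    y ∈ unobservable D B n ↔ ∀ j < n, D ((B ^ j) y) = 0 := Iff.rfl

theorem map_aeval_of_map_pow {D B : X →L[ℂ] X} {n : ℕ} {y : X} {a : ℂ}
    (h : ∀ j < n, D ((B ^ j) y) = a ^ j • D y) (p : ℂ[X]) (hp : p.natDegree < n) :
    D (aeval B p y) = p.eval a • D y := by
  rw [aeval_eq_sum_range' hp, eval_eq_sum_range' hp, Finset.sum_smul, sum_apply, map_sum]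
  refine Finset.sum_congr rfl fun j hj => ?_
  rw [smul_apply, map_smul, h j (Finset.mem_range.1 hj), smul_smul]

/-- The denominator of a Blaschke product with the given poles. -/
noncomputable def poleProd {n : ℕ} (α : Fin n → ℂ) : ℂ[X] := ∏ k, (Polynomial.X - C (α k))

/-- The numerator of a Blaschke product with the given poles. -/
noncomputable def zeroProd {n : ℕ} (α : Fin n → ℂ) : ℂ[X] :=
  ∏ k, (Polynomial.X + C ((starRingEnd ℂ) (α k)))

theorem poleProd_succ {n : ℕ} (α : Fin (n + 1) → ℂ) :
    poleProd α = (Polynomial.X - C (α 0)) * poleProd (fun k : Fin n => α k.succ) :=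
  Fin.prod_univ_succ _

theorem zeroProd_succ {n : ℕ} (α : Fin (n + 1) → ℂ) :
    zeroProd α = (Polynomial.X + C ((starRingEnd ℂ) (α 0))) *
      zeroProd (fun k : Fin n => α k.succ) :=
  Fin.prod_univ_succ _

theorem natDegree_zeroProd_le {n : ℕ} (α : Fin n → ℂ) : (zeroProd α).natDegree ≤ n := by
  refine (natDegree_prod_le _ _).trans ?_
  simp

theorem eval_zeroProd_ne_zero {n : ℕ} {α : Fin n → ℂ} (hα : ∀ k, (α k).re < 0) {z : ℂ}
    (hz : z.re < 0) : (zeroProd α).eval z ≠ 0 := by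
  rw [zeroProd, eval_prod, Finset.prod_ne_zero_iff]
  intro k _ h
  have := congrArg Complex.re h
  simp at this
  linarith [hα k]

theorem IsStable.re_pos_of_hasEigenvalue_neg {A : X →L[ℂ] X} (hA : IsStable A) (z : ℂ)
    (hz : Module.End.HasEigenvalue ((-A : X →L[ℂ] X) : X →ₗ[ℂ] X) z) : 0 < z.re := by
  obtain ⟨v, hv⟩ := hz.exists_hasEigenvector
  have h : -A v = z • v := hv.apply_eq_smul
  have := hA (-z) (Module.End.hasEigenvalue_of_hasEigenvector
    (x := v) ⟨Module.End.mem_eigenspace_iff.2 (by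
      change A v = -z • v
      rw [neg_smul, ← h, neg_neg]), hv.2⟩)
  simpa using this

theorem opRank_neg [FiniteDimensional ℂ X] (T : X →L[ℂ] X) : opRank (-T) = opRank T := by
  rw [opRank, opRank, ← LinearMap.range_neg (T : X →ₗ[ℂ] X)]
  rfl

/-! ### Norm inequality and its equality case. -/

section Complete

variable [CompleteSpace X]

theorem norm_sq_sub_norm_sq (B : X →L[ℂ] X) (a : ℂ) (x : X) :
    ‖(B - algebraMap ℂ _ a) x‖ ^ 2 - ‖(B + algebraMap ℂ _ ((starRingEnd ℂ) a)) x‖ ^ 2 =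
      -2 * a.re * RCLike.re ⟪(adjoint B + B) x, x⟫_ℂ := by
  have h1 : (B - algebraMap ℂ (X →L[ℂ] X) a) x = B x - a • x := by
    simp [Algebra.algebraMap_eq_smul_one]
  have h2 : (B + algebraMap ℂ (X →L[ℂ] X) ((starRingEnd ℂ) a)) x =
      B x + (starRingEnd ℂ) a • x := by
    simp [Algebra.algebraMap_eq_smul_one]
  rw [h1, h2, @norm_sub_sq ℂ, @norm_add_sq ℂ, add_apply, inner_add_left, adjoint_inner_left,
    inner_smul_right, inner_smul_right, norm_smul, norm_smul]
  have h3 : (⟪x, B x⟫_ℂ).re = (⟪B x, x⟫_ℂ).re := inner_re_symm (𝕜 := ℂ) _ _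
  simp [h3]
  ring

theorem norm_sq_sqrt_apply {P : X →L[ℂ] X} (hP : 0 ≤ P) (x : X) :
    ‖CFC.sqrt P x‖ ^ 2 = RCLike.re ⟪P x, x⟫_ℂ := by
  have hsa : adjoint (CFC.sqrt P) = CFC.sqrt P :=
    ((nonneg_iff_isPositive _).1 (CFC.sqrt_nonneg P)).isSelfAdjoint.adjoint_eq
  have hs : CFC.sqrt P * CFC.sqrt P = P := CFC.sqrt_mul_sqrt_self P hP
  rw [← @inner_self_eq_norm_sq ℂ, ← adjoint_inner_left, hsa, ← mul_apply_eq, hs]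

theorem apply_eq_zero_of_re_inner_eq_zero {D : X →L[ℂ] X} (hD : 0 ≤ D) {x : X}
    (h : RCLike.re ⟪D x, x⟫_ℂ = 0) : D x = 0 := by
  have h0 : CFC.sqrt D x = 0 := by
    rw [← norm_eq_zero, ← sq_eq_zero_iff, norm_sq_sqrt_apply hD, h]
  rw [← CFC.sqrt_mul_sqrt_self D hD, mul_apply_eq, h0, map_zero]

theorem norm_aeval_zeroProd {B : X →L[ℂ] X} (hB : 0 ≤ adjoint B + B) {n : ℕ} (α : Fin n → ℂ)
    (hα : ∀ k, (α k).re < 0) (y : X) :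
    ‖aeval B (zeroProd α) y‖ ≤ ‖aeval B (poleProd α) y‖ ∧
      (‖aeval B (zeroProd α) y‖ = ‖aeval B (poleProd α) y‖ ↔
        y ∈ unobservable (adjoint B + B) B n) := by
  induction n generalizing y with
  | zero => simp [zeroProd, poleProd, mem_unobservable]
  | succ n ih =>
    set D := adjoint B + B with hDdef
    set β : Fin n → ℂ := fun k => α k.succ
    have hβ : ∀ k, (β k).re < 0 := fun k => hα _
    set a := α 0 with ha
    have haneg : a.re < 0 := hα 0
    set z := aeval B (zeroProd β) y with hz
    set u := (B - algebraMap ℂ (X →L[ℂ] X) a) y with hu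
    have hq : aeval B (poleProd α) y = aeval B (poleProd β) u := by
      rw [poleProd_succ, mul_comm, map_mul, mul_apply_eq]; simp [hu, ha, β]
    have hp : aeval B (zeroProd α) y = (B + algebraMap ℂ _ ((starRingEnd ℂ) a)) z := by
      rw [zeroProd_succ, map_mul, mul_apply_eq]; simp [hz, ha, β]
    have hc : aeval B (zeroProd β) u = (B - algebraMap ℂ (X →L[ℂ] X) a) z := by
      have : aeval B (zeroProd β) * (B - algebraMap ℂ (X →L[ℂ] X) a) =
          (B - algebraMap ℂ (X →L[ℂ] X) a) * aeval B (zeroProd β) := by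
        have := congrArg (aeval B) (mul_comm (zeroProd β) (Polynomial.X - C a))
        simpa using this
      exact congrArg (fun T : X →L[ℂ] X => T y) this
    obtain ⟨hle, hiff⟩ := ih β hβ u
    have hpos : 0 ≤ RCLike.re ⟪D z, z⟫_ℂ :=
      ((nonneg_iff_isPositive D).1 hB).re_inner_nonneg_left z
    have hid := norm_sq_sub_norm_sq B a z
    rw [← hDdef] at hid
    rw [hq, hp]
    rw [hc] at hle hiff
    have hle2 : ‖(B + algebraMap ℂ _ ((starRingEnd ℂ) a)) z‖ ≤
        ‖(B - algebraMap ℂ (X →L[ℂ] X) a) z‖ := by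
      refine le_of_sq_le_sq ?_ (norm_nonneg _)
      nlinarith
    have hz_iff : ‖(B + algebraMap ℂ _ ((starRingEnd ℂ) a)) z‖ =
        ‖(B - algebraMap ℂ (X →L[ℂ] X) a) z‖ ↔ D z = 0 := by
      constructor
      · intro h
        rw [h, sub_self] at hid
        refine apply_eq_zero_of_re_inner_eq_zero hB ?_
        have : a.re ≠ 0 := haneg.ne
        simpa [this] using hid.symm
      · intro h
        rw [h] at hid
        simp only [inner_zero_left, map_zero, mul_zero] at hid
        exact (sq_eq_sq₀ (norm_nonneg _) (norm_nonneg _)).1 (by linarith)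
    have hpow : ∀ j, D ((B ^ j) u) = D ((B ^ (j + 1)) y) - a • D ((B ^ j) y) := by
      intro j
      have : u = B y - a • y := by simp [hu, Algebra.algebraMap_eq_smul_one]
      rw [this, map_sub, map_smul, map_sub, map_smul, pow_succ, mul_apply_eq]
    refine ⟨hle2.trans hle, ?_⟩
    have hsplit : ‖(B + algebraMap ℂ _ ((starRingEnd ℂ) a)) z‖ = ‖aeval B (poleProd β) u‖ ↔
        D z = 0 ∧ u ∈ unobservable D B n := by
      rw [← hz_iff, ← hiff]
      constructor
      · intro h
        constructor <;> linarith
      · rintro ⟨h1, h2⟩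
        rw [h1, h2]
    rw [hsplit]
    have hdeg : (zeroProd β).natDegree < n + 1 := Nat.lt_succ_of_le (natDegree_zeroProd_le β)
    constructor
    · rintro ⟨hDz, hmem⟩
      -- Membership of `u = (B - a)y` makes `D B^j y` geometric with ratio `a`, so `D z` is `Z_β(a)
      -- • D y`. The zeros of `Z_β` lie in the right half plane and `Re a < 0`, which forces `D y =
      -- 0`.
      have hgeom : ∀ j < n + 1, D ((B ^ j) y) = a ^ j • D y := by
        intro j
        induction j with
        | zero => simp
        | succ j ihj =>
          intro hj
          have h := hmem j (by omega)
          rw [hpow, sub_eq_zero] at h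
          rw [h, ihj (by omega), smul_smul, pow_succ']
      rw [hz, map_aeval_of_map_pow hgeom _ hdeg, smul_eq_zero] at hDz
      have hDy := hDz.resolve_left (eval_zeroProd_ne_zero hβ haneg)
      intro j hj
      rw [hgeom j hj, hDy, smul_zero]
    · intro hmem
      have hDy : D y = 0 := by simpa using hmem 0 (by omega)
      refine ⟨?_, fun j hj => ?_⟩
      · have hgeom : ∀ j < n + 1, D ((B ^ j) y) = a ^ j • D y := by
          intro j hj
          rw [hmem j hj, hDy, smul_zero]
        rw [hz, map_aeval_of_map_pow hgeom _ hdeg, hDy, smul_zero]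
      · rw [hpow, hmem _ (by omega), hmem _ (by omega), smul_zero, sub_zero]

theorem norm_sq_defectOperator_apply {T : X →L[ℂ] X} (hT : ‖T‖ ≤ 1) (x : X) :
    ‖defectOperator T x‖ ^ 2 = ‖x‖ ^ 2 - ‖T x‖ ^ 2 := by
  have h : ∀ x, RCLike.re ⟪(1 - adjoint T * T) x, x⟫_ℂ = ‖x‖ ^ 2 - ‖T x‖ ^ 2 := by
    intro x
    rw [sub_apply, inner_sub_left, mul_apply_eq, adjoint_inner_left, show (1 : X →L[ℂ] X) x = x from rfl, map_sub,
      inner_self_eq_norm_sq, inner_self_eq_norm_sq]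
  rw [defectOperator, norm_sq_sqrt_apply, h]
  rw [nonneg_iff_isPositive, isPositive_def']
  refine ⟨(IsSelfAdjoint.one _).sub (IsSelfAdjoint.star_mul_self T), fun x => ?_⟩
  rw [reApplyInnerSelf_apply, h, sub_nonneg]
  have : ‖T x‖ ≤ ‖x‖ := by simpa using T.le_of_opNorm_le hT x
  gcongr

/-! ### Invertibility and dimension count. -/

variable [FiniteDimensional ℂ X]

theorem isUnit_sub_algebraMap {B : X →L[ℂ] X} {a : ℂ}
    (h : ¬ Module.End.HasEigenvalue (B : X →ₗ[ℂ] X) a) :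
    IsUnit (B - algebraMap ℂ (X →L[ℂ] X) a) := by
  have hinj : Function.Injective (B - algebraMap ℂ (X →L[ℂ] X) a : X →L[ℂ] X) := by
    rw [injective_iff_map_eq_zero]
    intro x hx
    by_contra hne
    refine h (Module.End.hasEigenvalue_of_hasEigenvector
      (x := x) ⟨Module.End.mem_eigenspace_iff.2 ?_, hne⟩)
    simpa [Algebra.algebraMap_eq_smul_one, sub_eq_zero] using hx
  rw [ContinuousLinearMap.isUnit_iff_bijective]
  exact ⟨hinj, LinearMap.surjective_of_injective
    (f := ((B - algebraMap ℂ (X →L[ℂ] X) a : X →L[ℂ] X) : X →ₗ[ℂ] X)) hinj⟩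

theorem isUnit_aeval_poleProd {B : X →L[ℂ] X}
    (hB : ∀ z : ℂ, Module.End.HasEigenvalue (B : X →ₗ[ℂ] X) z → 0 < z.re) {n : ℕ} {α : Fin n → ℂ}
    (hα : ∀ k, (α k).re < 0) : IsUnit (aeval B (poleProd α)) := by
  induction n with
  | zero => simp [poleProd]
  | succ n ih =>
    rw [poleProd_succ, map_mul]
    refine IsUnit.mul ?_ (ih fun k => hα _)
    simpa using isUnit_sub_algebraMap (B := B) fun h => (hB _ h).not_gt (hα 0)

/-- Otherwise `B` has an eigenvector `v` in `W` with eigenvalue `z`, and `0 = ⟪Dv, v⟫ = 2 Re z ‖v‖²`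
contradicts `Re z > 0`. -/
theorem unobservable_eq_bot_of_invariant {B : X →L[ℂ] X}
    (hB : ∀ z : ℂ, Module.End.HasEigenvalue (B : X →ₗ[ℂ] X) z → 0 < z.re)
    {W : Submodule ℂ X} (hW : ∀ x ∈ W, B x ∈ W) (hD : ∀ x ∈ W, (adjoint B + B) x = 0) :
    W = ⊥ := by
  by_contra hne
  have : Nontrivial W := Submodule.nontrivial_iff_ne_bot.2 hne
  obtain ⟨z, hz⟩ := Module.End.exists_eigenvalue ((B : X →ₗ[ℂ] X).restrict hW)
  obtain ⟨v, hv⟩ := hz.exists_hasEigenvector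
  have hv0 : (v : X) ≠ 0 := fun h => hv.2 (Subtype.ext h)
  have hBv : B (v : X) = z • (v : X) := congrArg Subtype.val hv.apply_eq_smul
  have hzpos : 0 < z.re := hB z (Module.End.hasEigenvalue_of_hasEigenvector
    (x := (v : X)) ⟨Module.End.mem_eigenspace_iff.2 hBv, hv0⟩)
  have h : RCLike.re ⟪(adjoint B + B) (v : X), (v : X)⟫_ℂ = 0 := by
    rw [hD v v.2]; simp
  rw [add_apply, inner_add_left, adjoint_inner_left, hBv, inner_smul_left, inner_smul_right,
    inner_self_eq_norm_sq_to_K] at h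
  have hn' : v ≠ 0 := hv.2
  simp [← Complex.ofReal_pow, hn', hzpos.ne'] at h

theorem finrank_unobservable {B : X →L[ℂ] X}
    (hB : ∀ z : ℂ, Module.End.HasEigenvalue (B : X →ₗ[ℂ] X) z → 0 < z.re)
    (hrank : opRank (adjoint B + B) = 1) (n : ℕ) :
    Module.finrank ℂ (unobservable (adjoint B + B) B n) = Module.finrank ℂ X - n := by
  set D := adjoint B + B with hDdef
  induction n with
  | zero =>
    have : unobservable D B 0 = ⊤ := by
      ext y; simp [mem_unobservable]
    rw [this]; simp
  | succ n ih =>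
    set U := unobservable D B n with hU
    set V := unobservable D B (n + 1) with hV
    have hVU : V ≤ U := fun y hy j hj => hy j (by omega)
    let f : U →ₗ[ℂ] LinearMap.range (D : X →ₗ[ℂ] X) :=
      ((D : X →ₗ[ℂ] X).rangeRestrict ∘ₗ ((B ^ n : X →L[ℂ] X) : X →ₗ[ℂ] X)) ∘ₗ U.subtype
    have hker : V = (LinearMap.ker f).map U.subtype := by
      ext y
      simp only [Submodule.mem_map, LinearMap.mem_ker]
      constructor
      · intro hy
        exact ⟨⟨y, hVU hy⟩, Subtype.ext (hy n (by omega)), rfl⟩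
      · rintro ⟨⟨w, hw⟩, hfw, rfl⟩ j hj
        rcases Nat.lt_succ_iff_lt_or_eq.1 hj with h | rfl
        · exact hw j h
        · exact congrArg Subtype.val hfw
    have hdimV : Module.finrank ℂ V = Module.finrank ℂ (LinearMap.ker f) := by
      rw [hker]
      exact (Submodule.equivMapOfInjective _ U.injective_subtype _).finrank_eq.symm
    have hle : Module.finrank ℂ (LinearMap.range f) ≤ 1 :=
      (Submodule.finrank_le _).trans_eq hrank
    have hsum := f.finrank_range_add_finrank_ker
    -- If the chain stalls, `U` is `B`-invariant and inside `ker D`, hence zero; truncated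
    -- subtraction covers this case. Otherwise the drop is exactly one.
    by_cases hVU' : V = U
    · have hbot : U = ⊥ := by
        refine unobservable_eq_bot_of_invariant hB (fun x hx j hj => ?_) (fun x hx => ?_)
        · rw [← hVU'] at hx
          have := hx (j + 1) (by omega)
          rwa [pow_succ, mul_apply_eq] at this
        · rw [← hVU'] at hx
          exact hx 0 (by omega)
      have h0 : Module.finrank ℂ U = 0 := by rw [hbot]; simp
      rw [hVU', h0]
      omega
    · have := Submodule.finrank_lt_finrank_of_lt (lt_of_le_of_ne hVU hVU')
      omega

/-! ### Blaschke products of operators. -/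

theorem ratEval_blaschke {B : X →L[ℂ] X}
    (hB : ∀ z : ℂ, Module.End.HasEigenvalue (B : X →ₗ[ℂ] X) z → 0 < z.re)
    (hD : 0 ≤ adjoint B + B) (hrank : opRank (adjoint B + B) = 1)
    {φ : RatFunc ℂ} {n : ℕ} (hφ : IsBlaschkeProduct φ n) :
    RatDefinedAt φ B ∧ ‖ratEval φ B‖ ≤ 1 ∧
      defectIndex (ratEval φ B) = min n (Module.finrank ℂ X) := by
  obtain ⟨ρ, α, hρ, hα, hφ⟩ := hφ
  have hq0 : poleProd α ≠ 0 := Finset.prod_ne_zero_iff.2 fun k _ => X_sub_C_ne_zero _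
  have hφ' : φ = algebraMap ℂ[X] (RatFunc ℂ) (C ρ * zeroProd α) /
      algebraMap ℂ[X] (RatFunc ℂ) (poleProd α) := by
    rw [hφ, zeroProd, poleProd, Finset.prod_div_distrib]
    simp [map_prod, mul_div_assoc]
  have hQ := isUnit_aeval_poleProd hB hα
  -- Divisibility and cross-multiplication suffice here, so coprimality of `Z` and `Q` need not be
  -- proved.
  have hdvd : φ.denom ∣ poleProd α := by
    rw [RatFunc.denom_dvd hq0]
    exact ⟨_, hφ'⟩
  have hdef : IsUnit (aeval B φ.denom) := by
    obtain ⟨r, hr⟩ := hdvd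
    rw [hr, map_mul] at hQ
    refine ((Commute.isUnit_mul_iff ?_).1 hQ).1
    rw [Commute, SemiconjBy, ← map_mul, mul_comm, map_mul]
  have hcross : φ.num * poleProd α = C ρ * zeroProd α * φ.denom := by
    rw [hφ']
    exact RatFunc.num_mul_eq_mul_denom_iff hq0 |>.2 rfl
  set T := ratEval φ B with hT
  have hTQ : T * aeval B (poleProd α) = aeval B (C ρ * zeroProd α) := by
    have hcomm : aeval B φ.denom * aeval B (poleProd α) =
        aeval B (poleProd α) * aeval B φ.denom := by
      rw [← map_mul, mul_comm, map_mul]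
    refine hdef.mul_right_cancel ?_
    rw [mul_assoc, ← hcomm, ← mul_assoc, hT, ratEval, mul_assoc (aeval B φ.num),
      Ring.inverse_mul_cancel _ hdef, mul_one, ← map_mul, hcross, map_mul]
  have hTx : ∀ y, ‖T (aeval B (poleProd α) y)‖ = ‖aeval B (zeroProd α) y‖ := by
    intro y
    rw [← mul_apply_eq, hTQ, map_mul, mul_apply_eq, aeval_C, Algebra.algebraMap_eq_smul_one]
    simp [norm_smul, hρ]
  have hbij := ContinuousLinearMap.isUnit_iff_bijective.1 hQ
  have hTnorm : ‖T‖ ≤ 1 := by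
    refine T.opNorm_le_bound zero_le_one fun x => ?_
    obtain ⟨y, rfl⟩ := hbij.2 x
    rw [hTx, one_mul]
    exact (norm_aeval_zeroProd hD α hα y).1
  refine ⟨hdef, hTnorm, ?_⟩
  set Q : X →L[ℂ] X := aeval B (poleProd α)
  have hker : LinearMap.ker (defectOperator T : X →ₗ[ℂ] X) =
      (unobservable (adjoint B + B) B n).map (Q : X →ₗ[ℂ] X) := by
    have hmem : ∀ y, defectOperator T (Q y) = 0 ↔ y ∈ unobservable (adjoint B + B) B n := by
      intro y
      rw [← (norm_aeval_zeroProd hD α hα y).2, ← norm_eq_zero, ← sq_eq_zero_iff,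
        norm_sq_defectOperator_apply hTnorm, hTx, sub_eq_zero, eq_comm,
        sq_eq_sq₀ (norm_nonneg _) (norm_nonneg _)]
    ext x
    obtain ⟨y, rfl⟩ := hbij.2 x
    rw [LinearMap.mem_ker, Submodule.mem_map]
    refine (hmem y).trans ⟨fun h => ⟨y, h, rfl⟩, ?_⟩
    rintro ⟨w, hw, hwy⟩
    rwa [← hbij.1 hwy]
  have hdim : Module.finrank ℂ (LinearMap.ker (defectOperator T : X →ₗ[ℂ] X)) =
      Module.finrank ℂ X - n := by
    rw [hker, ← finrank_unobservable hB hrank n]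
    exact (Submodule.equivMapOfInjective (Q : X →ₗ[ℂ] X) hbij.1 _).finrank_eq.symm
  have hsum := (defectOperator T : X →ₗ[ℂ] X).finrank_range_add_finrank_ker
  rw [defectIndex, opRank]
  -- Rank–nullity with `d - (d - n) = min n d` for truncated subtraction.
  omega

theorem IsStable.adjoint {A : X →L[ℂ] X} (hA : IsStable A) : IsStable (adjoint A) := by
  intro z hz
  by_contra hre
  have hunit : IsUnit (A - algebraMap ℂ (X →L[ℂ] X) ((starRingEnd ℂ) z)) :=
    isUnit_sub_algebraMap fun h => hre (by simpa using hA _ h)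
  have hstar := hunit.star
  have heq : star (A - algebraMap ℂ (X →L[ℂ] X) ((starRingEnd ℂ) z)) =
      ContinuousLinearMap.adjoint A - algebraMap ℂ (X →L[ℂ] X) z := by
    rw [star_sub, star_eq_adjoint, ← algebraMap_star_comm]
    simp
  rw [heq] at hstar
  obtain ⟨v, hv⟩ := hz.exists_hasEigenvector
  refine hv.2 ((ContinuousLinearMap.isUnit_iff_bijective.1 hstar).1 ?_)
  have := hv.apply_eq_smul
  rw [map_zero]
  simpa [Algebra.algebraMap_eq_smul_one, sub_eq_zero] using this

/-- The values of a Blaschke product at `-A`, for a stable dissipative operator `A` with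
`A* + A` of rank one. -/
theorem ratEval_neg_blaschke {A : X →L[ℂ] X} (hstable : IsStable A) (hdiss : IsDissipative A)
    (hrank : opRank (adjoint A + A) = 1) {φ : RatFunc ℂ} {n : ℕ} (hφ : IsBlaschkeProduct φ n) :
    RatDefinedAt φ (-A) ∧ ‖ratEval φ (-A)‖ ≤ 1 ∧
      defectIndex (ratEval φ (-A)) = min n (Module.finrank ℂ X) := by
  have h : adjoint (-A) + -A = -(adjoint A + A) := by
    rw [map_neg, neg_add]
  refine ratEval_blaschke hstable.re_pos_of_hasEigenvalue_neg ?_ ?_ hφ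
  · rw [h]
    exact neg_nonneg.2 hdiss
  · rw [h, opRank_neg, hrank]

end Complete

end BlaschkeDefect

theorem corollary4p4 {X : Type*} [NormedAddCommGroup X] [InnerProductSpace ℂ X]
    [CompleteSpace X] [FiniteDimensional ℂ X] (A : X →L[ℂ] X)
    (hstable : BlaschkeDefect.IsStable A) (hdiss : BlaschkeDefect.IsDissipative A)
    (hrank : BlaschkeDefect.opRank (ContinuousLinearMap.adjoint A + A) = 1)
    (φ : RatFunc ℂ) (n : ℕ) (hφ : BlaschkeDefect.IsBlaschkeProduct φ n) :
    -- `φ(-A)` and `φ(-A*)` are well defined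
    (BlaschkeDefect.RatDefinedAt φ (-A) ∧
      BlaschkeDefect.RatDefinedAt φ (-ContinuousLinearMap.adjoint A)) ∧
    -- they are contractions, so that their defect indices are meaningful
    (‖BlaschkeDefect.ratEval φ (-A)‖ ≤ 1 ∧
      ‖BlaschkeDefect.ratEval φ (-ContinuousLinearMap.adjoint A)‖ ≤ 1) ∧
    BlaschkeDefect.defectIndex (BlaschkeDefect.ratEval φ (-A)) =
      min n (Module.finrank ℂ X) ∧
    BlaschkeDefect.defectIndex (BlaschkeDefect.ratEval φ (-ContinuousLinearMap.adjoint A)) =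
      min n (Module.finrank ℂ X) := by
  have hadj : ContinuousLinearMap.adjoint (ContinuousLinearMap.adjoint A) +
      ContinuousLinearMap.adjoint A = ContinuousLinearMap.adjoint A + A := by
    rw [ContinuousLinearMap.adjoint_adjoint, add_comm]
  obtain ⟨h1, h2, h3⟩ := BlaschkeDefect.ratEval_neg_blaschke hstable hdiss hrank hφ
  obtain ⟨h4, h5, h6⟩ := BlaschkeDefect.ratEval_neg_blaschke hstable.adjoint
    (hadj.trans_le hdiss) (by rw [hadj, hrank]) hφ
  exact ⟨⟨h1, h4⟩, ⟨h2, h5⟩, h3, h6⟩
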